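/- Let $R>0$, let $B=\{y\in\mathbb R^2:|y|<R\}$, let $S=\partial B$ be its boundary circle with exterior unit normal $n(z)=z/R$ and arc length element $dl$, and let $f:\mathbb R^2\to\mathbb R$ be continuously differentiable and supported in the closed disk $\overline B$. For $z\in S$ and $t\ge 0$ let $$g(z,t)=\int_0^{2\pi} f\bigl(z+t(\cos\theta,\sin\theta)\bigr)\,t\,d\theta$$ be the integral of $f$ with respect to arc length over the circle of radius $t$ centered at $z$. Then for every $y\in B$ $$f(y)=\frac{1}{2\pi^2}\,\mathrm{div}_y\int_S n(z)\left[\mathrm{p.v.}\!\int_0^{2R} g(z,t')\,\frac{1}{t'^2-|y-z|^2}\,dt'\right]dl(z),$$ where the inner integral is a Cauchy principal value at $t'=|y-z|$, that is, the limit as $\varepsilon\to0^+$ of the integral over $\{t'\in[0,2R]: |t'-|y-z||>\varepsilon\}$. Here, for every $y\in B$, the principal value exists for every $z\in S$, the outer integrand is integrable over $S$, and the vector field of $y$ defined by the outer integral is differentiable at $y$. -/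

import Mathlib

open Set Filter Topology MeasureTheory

noncomputable section

/-- The Euclidean plane. -/
abbrev Plane : Type := EuclideanSpace ℝ (Fin 2)

/-- The unit vector of the plane at polar angle `θ`. -/
def unitVec (θ : ℝ) : Plane := !₂[Real.cos θ, Real.sin θ]

/-- The integral of `F` over the circle of radius `r` with center `z`, with respect to
arc length: `∫ F dl`, where `dl = r dθ` at the point `z + r (cos θ, sin θ)`. -/
def circleLineIntegral {E : Type*} [NormedAddCommGroup E] [NormedSpace ℝ E]
    (F : Plane → E) (z : Plane) (r : ℝ) : E :=
  ∫ θ in (0 : ℝ)..(2 * Real.pi), r • F (z + r • unitVec θ)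

/-- Integrability of `F` over the circle of radius `r` with center `z` for arc length. -/
def CircleLineIntegrable {E : Type*} [NormedAddCommGroup E]
    (F : Plane → E) (z : Plane) (r : ℝ) : Prop :=
  IntervalIntegrable (fun θ : ℝ => F (z + r • unitVec θ)) volume 0 (2 * Real.pi)

/-- The circular integrals `g(z,t)` of `f`: the integral of `f` (not its average) with respect
to arc length over the circle of radius `t` centered at `z`. -/
def circularIntegral (f : Plane → ℝ) (z : Plane) (t : ℝ) : ℝ :=
  circleLineIntegral f z t

/-- The interval `[a,b]` with the symmetric neighbourhood `[c-ε,c+ε]` of `c` removed. -/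
def punctured (a b c ε : ℝ) : Set ℝ := {t | t ∈ Icc a b ∧ ε < |t - c|}

/-- The Cauchy principal value of `∫ t in a..b, φ t` at the singularity `c` exists and is `v`. -/
def HasPrincipalValue (φ : ℝ → ℝ) (a b c v : ℝ) : Prop :=
  (∀ ε : ℝ, 0 < ε → IntegrableOn φ (punctured a b c ε)) ∧
    Tendsto (fun ε : ℝ => ∫ t in punctured a b c ε, φ t) (𝓝[>] 0) (𝓝 v)

/-- The Cauchy principal value of `∫ t in a..b, φ t` at the singularity `c`
(meaningful when some `v` satisfies `HasPrincipalValue φ a b c v`, and then equal to `v`). -/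
def principalValue (φ : ℝ → ℝ) (a b c : ℝ) : ℝ :=
  limUnder (𝓝[>] (0 : ℝ)) (fun ε : ℝ => ∫ t in punctured a b c ε, φ t)

/-- The integrand `t' ↦ g(z,t') / (t'² - t²)` of the filtration. -/
def filterIntegrand (g : Plane → ℝ → ℝ) (z : Plane) (t t' : ℝ) : ℝ :=
  g z t' * (1 / (t' ^ 2 - t ^ 2))

/-- The filtered data `h(z,t) = p.v. ∫₀^{2R} g(z,t') / (t'² - t²) dt'`. -/
def filteredData (R : ℝ) (g : Plane → ℝ → ℝ) (z : Plane) (t : ℝ) : ℝ :=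
  principalValue (filterIntegrand g z t) 0 (2 * R) t

/-- The exterior unit normal at a point `z` of the circle of radius `R` about the origin. -/
def outerNormal (R : ℝ) (z : Plane) : Plane := R⁻¹ • z

/-- The backprojection integrand `z ↦ n(z) h(z,|y-z|)`. -/
def backprojectionIntegrand (R : ℝ) (g : Plane → ℝ → ℝ) (y z : Plane) : Plane :=
  filteredData R g z ‖y - z‖ • outerNormal R z

/-- The vector field `y ↦ ∫_S n(z) h(z,|y-z|) dl(z)`, where `S` is the circle of radius `R`
about the origin. -/
def backprojection (R : ℝ) (g : Plane → ℝ → ℝ) (y : Plane) : Plane :=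
  circleLineIntegral (backprojectionIntegrand R g y) 0 R

/-- The divergence of a vector field in the plane (meaningful where it is differentiable). -/
def planeDiv (V : Plane → Plane) (y : Plane) : ℝ :=
  ∑ i : Fin 2, (fderiv ℝ V y (EuclideanSpace.single i (1 : ℝ))) i

end

/-!
Inside the disk the backprojected field is a gradient: for `|y| < R`,
`V(y) = ∫_S n(z) h(z, |y - z|) dl(z) = π ∫ f(x) (y - x) / |y - x|² dx`,
which is `π` times the gradient of the logarithmic potential of `f`. As the Laplacian of
`log |x|` is `2π δ`, the divergence of `V` is `2π² f`.

To prove the formula for `V`, the singular factor `1 / σ` with `σ = t'² - |y - z|²` is replaced by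
`σ / (σ² + ε²)` (`regInv`). Polar coordinates about `z` and Fubini's theorem then write the
regularized field as `∫ f(x) K_ε(x, y) dx`. For `z = R (cos θ, sin θ)`, the difference
`|x - z|² - |y - z|²` equals `2r (s - R cos (θ - α))`, where `r` and `α` are the polar coordinates of
`x - y` and `s` is the component of the midpoint of `x` and `y` along `x - y`. Hence `K_ε` is a
multiple of `x - y` whose size is governed by `∫ dφ / (w - R cos φ)` at `w = s + iε / (2r)`
(`cosResolvent`), a square root of `4π² / (w² - R²)` (`cosResolvent_sq_mul`). Since
`|s| ≤ (|x| + |y|) / 2` stays away from `R`, this root is bounded uniformly in `ε`, and it becomes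
purely imaginary as `ε → 0`: the principal value of `∫ dφ / (s - R cos φ)` vanishes for `|s| < R`.
So `K_ε(x, y)` tends to `π (y - x) / |y - x|²`, dominated by a multiple of `1 / |x - y|`.

On the other side, `g(z, t) = t M(z, t)` with `M` Lipschitz in `t`. Subtracting `M(z, |y - z|)` gives
a closed form for the principal value (`pvClosedForm`) to which the sharply truncated and the
regularized integrals both converge, the latter with a bound independent of `ε` and continuous
in `z`. Thus the limit passes through the integral over `S` as well (`backprojection_eq`).

The field `V` is a convolution of the locally integrable kernel `x / |x|²` with a compactly supported
`C¹` function, hence differentiable, and its divergence is computed in polar coordinates about `y`,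
where the derivative of `f` along each ray integrates to `f y` (`integral_fderiv_logGradient`).
-/

noncomputable section

/-! ### Polar coordinates in the plane -/

@[fun_prop]
theorem continuous_unitVec : Continuous unitVec := by
  unfold unitVec
  fun_prop

theorem norm_unitVec (θ : ℝ) : ‖unitVec θ‖ = 1 := by
  simp [unitVec, EuclideanSpace.norm_eq]

theorem unitVec_periodic : Function.Periodic unitVec (2 * Real.pi) := by
  intro θ
  simp [unitVec]

/-- The area integral of `F` in polar coordinates. The integrand `r F(r cos θ, r sin θ)` is
replaced by a continuous function `Φ` agreeing with it for `r > 0`, which allows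
a singularity of order `1 / r` of `F` at the origin. -/
theorem integral_eq_polar {F : Plane → ℝ} {Φ : ℝ × ℝ → ℝ} {ρ : ℝ} (hρ : 0 ≤ ρ)
    (hΦ : Continuous Φ) (hF : ∀ r θ, 0 < r → Φ (r, θ) = r * F (r • unitVec θ))
    (hsupp : ∀ r θ, ρ < r → Φ (r, θ) = 0)
    (hper : ∀ r, Function.Periodic (fun θ => Φ (r, θ)) (2 * Real.pi)) :
    ∫ x, F x = ∫ r in (0 : ℝ)..ρ, ∫ θ in (0 : ℝ)..(2 * Real.pi), Φ (r, θ) := by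
  have h1 : ∫ x, F x = ∫ p : ℝ × ℝ, F (!₂[p.1, p.2]) := by
    rw [← ((PiLp.volume_preserving_toLp (Fin 2)).comp
      ((volume_preserving_finTwoArrow ℝ).symm)).integral_comp]
    · rfl
    · exact (MeasurableEquiv.toLp 2 (Fin 2 → ℝ)).measurableEmbedding.comp
        (MeasurableEquiv.finTwoArrow (α := ℝ)).symm.measurableEmbedding
  rw [h1, ← integral_comp_polarCoord_symm]
  have h2 : ∫ p in polarCoord.target, p.1 • F (!₂[(polarCoord.symm p).1, (polarCoord.symm p).2])
      = ∫ p in polarCoord.target, Φ p := by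
    refine setIntegral_congr_fun polarCoord.open_target.measurableSet fun p hp => ?_
    have hv : (!₂[p.1 * Real.cos p.2, p.1 * Real.sin p.2] : Plane) = p.1 • unitVec p.2 := by
      ext i
      fin_cases i <;> simp [unitVec]
    simp only [polarCoord_symm_apply, smul_eq_mul, hv]
    exact (hF p.1 p.2 hp.1).symm
  have h3 : ∫ p in polarCoord.target, Φ p
      = ∫ p in Ioc 0 ρ ×ˢ Ioc (-Real.pi) Real.pi, Φ p := by
    have ha : (Ioc 0 ρ ×ˢ Ioo (-Real.pi) Real.pi : Set (ℝ × ℝ)) ⊆ polarCoord.target := by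
      rintro ⟨r, θ⟩ ⟨hr, hθ⟩
      exact ⟨hr.1, hθ⟩
    rw [setIntegral_eq_of_subset_of_forall_sdiff_eq_zero
      polarCoord.open_target.measurableSet ha]
    · refine setIntegral_congr_set ?_
      exact Measure.set_prod_ae_eq (ae_eq_refl _) Ioo_ae_eq_Ioc
    · rintro ⟨r, θ⟩ ⟨⟨hr, hθ⟩, hn⟩
      refine hsupp r θ ?_
      by_contra hle
      exact hn ⟨⟨hr, not_lt.mp hle⟩, hθ⟩
  have h4 : IntegrableOn Φ (Ioc 0 ρ ×ˢ Ioc (-Real.pi) Real.pi) :=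
    (hΦ.continuousOn.integrableOn_compact (isCompact_Icc.prod isCompact_Icc)).mono_set
      (prod_mono Ioc_subset_Icc_self Ioc_subset_Icc_self)
  rw [h2, h3, Measure.volume_eq_prod, setIntegral_prod _ h4, intervalIntegral.integral_of_le hρ]
  refine setIntegral_congr_fun measurableSet_Ioc fun r _ => ?_
  have h5 := (hper r).intervalIntegral_add_eq (-Real.pi) 0
  rw [zero_add, show -Real.pi + 2 * Real.pi = Real.pi by ring] at h5
  rw [← h5, intervalIntegral.integral_of_le (by linarith [Real.pi_pos])]

/-! ### The regularized Cauchy kernel and principal values -/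

/-- The real part of `1 / (σ + iε)`, a continuous substitute for `1 / σ`. -/
def regInv (ε σ : ℝ) : ℝ := σ / (σ ^ 2 + ε ^ 2)

theorem continuous_regInv {ε : ℝ} (hε : 0 < ε) : Continuous (regInv ε) := by
  unfold regInv
  exact continuous_id.div (by fun_prop) fun σ => by positivity

theorem abs_regInv_le (ε σ : ℝ) : |regInv ε σ| ≤ |σ|⁻¹ := by
  rcases eq_or_ne σ 0 with rfl | hσ
  · simp [regInv]
  have h : 0 < |σ| := abs_pos.mpr hσ
  have h2 : 0 < σ ^ 2 := by positivity
  rw [regInv, abs_div, abs_of_pos (by positivity : 0 < σ ^ 2 + ε ^ 2), div_le_iff₀ (by positivity),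
    ← div_eq_inv_mul, le_div_iff₀ h, ← sq, sq_abs]
  nlinarith [sq_nonneg ε]

theorem tendsto_regInv (σ : ℝ) : Tendsto (fun ε => regInv ε σ) (𝓝[>] 0) (𝓝 σ⁻¹) := by
  rcases eq_or_ne σ 0 with rfl | hσ
  · simp [regInv]
  have h : ContinuousAt (fun ε => regInv ε σ) 0 := by
    unfold regInv
    refine ContinuousAt.div (by fun_prop) (by fun_prop) ?_
    simpa using hσ
  have h0 : regInv 0 σ = σ⁻¹ := by
    simp only [regInv]
    field_simp
    simp
  rw [← h0]
  exact h.tendsto.mono_left nhdsWithin_le_nhds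

/-- The closed form of `p.v. ∫₀ᴬ s M(s) / (s² - t²) ds`: the singularity is removed by subtracting
`M t`, and the principal value of `s / (s² - t²)` is a logarithm. -/
def pvClosedForm (M : ℝ → ℝ) (A t : ℝ) : ℝ :=
  (∫ s in (0 : ℝ)..A, s * (M s - M t) * (s ^ 2 - t ^ 2)⁻¹)
    + M t * ((Real.log (A ^ 2 - t ^ 2) - Real.log (t ^ 2)) / 2)

theorem abs_mul_sub_mul_inv_le {M : ℝ → ℝ} {L : NNReal} (hM : LipschitzWith L M) {s t : ℝ}
    (hs : 0 ≤ s) (ht : 0 < t) : |s * (M s - M t)| * |s ^ 2 - t ^ 2|⁻¹ ≤ L := by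
  rcases eq_or_ne s t with rfl | hst
  · simp
  have h1 : |M s - M t| ≤ L * |s - t| := by
    simpa [Real.dist_eq] using hM.dist_le_mul s t
  have h2 : 0 < |s - t| := abs_pos.mpr (sub_ne_zero.mpr hst)
  have h3 : |s ^ 2 - t ^ 2| = |s - t| * (s + t) := by
    rw [show s ^ 2 - t ^ 2 = (s - t) * (s + t) by ring, abs_mul, abs_of_pos (by linarith : 0 < s + t)]
  rw [h3, ← div_eq_mul_inv, div_le_iff₀ (by positivity), abs_mul, abs_of_nonneg hs]
  calc s * |M s - M t| ≤ s * (L * |s - t|) := by gcongr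
    _ ≤ (s + t) * (L * |s - t|) := by gcongr; linarith
    _ = L * (|s - t| * (s + t)) := by ring

theorem integral_mul_regInv {A t ε : ℝ} (hε : 0 < ε) :
    ∫ s in (0 : ℝ)..A, s * regInv ε (s ^ 2 - t ^ 2)
      = (Real.log ((A ^ 2 - t ^ 2) ^ 2 + ε ^ 2) - Real.log ((t ^ 2) ^ 2 + ε ^ 2)) / 4 := by
  have hd : ∀ s ∈ uIcc (0 : ℝ) A, HasDerivAt (fun s => Real.log ((s ^ 2 - t ^ 2) ^ 2 + ε ^ 2) / 4)
      (s * regInv ε (s ^ 2 - t ^ 2)) s := by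
    intro s _
    have h0 : (s ^ 2 - t ^ 2) ^ 2 + ε ^ 2 ≠ 0 := by positivity
    have h1 := ((((((hasDerivAt_id s).pow 2).sub_const (t ^ 2)).pow 2).add_const
      (ε ^ 2)).log h0).div_const 4
    refine h1.congr_deriv ?_
    simp only [regInv, id, Nat.cast_ofNat, Pi.pow_apply]
    field_simp
    ring
  have hc : Continuous fun s => s * regInv ε (s ^ 2 - t ^ 2) :=
    continuous_id.mul ((continuous_regInv hε).comp (by fun_prop))
  rw [intervalIntegral.integral_eq_sub_of_hasDerivAt hd (hc.intervalIntegrable _ _)]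
  ring_nf

theorem integral_regInv_split {M : ℝ → ℝ} (hM : Continuous M) {A t ε : ℝ} (hε : 0 < ε) :
    ∫ s in (0 : ℝ)..A, s * M s * regInv ε (s ^ 2 - t ^ 2)
      = (∫ s in (0 : ℝ)..A, s * (M s - M t) * regInv ε (s ^ 2 - t ^ 2))
        + M t * ((Real.log ((A ^ 2 - t ^ 2) ^ 2 + ε ^ 2)
          - Real.log ((t ^ 2) ^ 2 + ε ^ 2)) / 4) := by
  have hk : Continuous fun s => regInv ε (s ^ 2 - t ^ 2) :=
    (continuous_regInv hε).comp (by fun_prop)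
  rw [← integral_mul_regInv hε, ← intervalIntegral.integral_const_mul,
    ← intervalIntegral.integral_add]
  · refine intervalIntegral.integral_congr fun s _ => ?_
    ring
  · exact Continuous.intervalIntegrable (by fun_prop) _ _
  · exact Continuous.intervalIntegrable (by fun_prop) _ _

theorem tendsto_integral_regInv {M : ℝ → ℝ} {L : NNReal} (hM : LipschitzWith L M) {A t : ℝ}
    (ht : 0 < t) (htA : t < A) :
    Tendsto (fun ε => ∫ s in (0 : ℝ)..A, s * M s * regInv ε (s ^ 2 - t ^ 2)) (𝓝[>] 0)
      (𝓝 (pvClosedForm M A t)) := by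
  have hMc := hM.continuous
  have hd : 0 < A ^ 2 - t ^ 2 := by nlinarith
  have h1 : Tendsto (fun ε => ∫ s in (0 : ℝ)..A, s * (M s - M t) * regInv ε (s ^ 2 - t ^ 2))
      (𝓝[>] 0) (𝓝 (∫ s in (0 : ℝ)..A, s * (M s - M t) * (s ^ 2 - t ^ 2)⁻¹)) := by
    refine intervalIntegral.tendsto_integral_filter_of_dominated_convergence (fun _ => (L : ℝ))
      ?_ ?_ (by simp) ?_
    · filter_upwards [self_mem_nhdsWithin] with ε hε
      have hk : Continuous fun s => regInv ε (s ^ 2 - t ^ 2) :=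
        (continuous_regInv hε).comp (by fun_prop)
      exact Continuous.aestronglyMeasurable (by fun_prop)
    · refine Eventually.of_forall fun ε => Eventually.of_forall fun s hs => ?_
      rw [uIoc_of_le (by linarith)] at hs
      rw [norm_mul, Real.norm_eq_abs, Real.norm_eq_abs]
      exact (mul_le_mul_of_nonneg_left (abs_regInv_le _ _) (abs_nonneg _)).trans
        (abs_mul_sub_mul_inv_le hM hs.1.le ht)
    · exact Eventually.of_forall fun s _ => (tendsto_regInv _).const_mul _
  have h2 : ∀ c : ℝ, 0 < c → Tendsto (fun ε : ℝ => Real.log (c ^ 2 + ε ^ 2)) (𝓝[>] 0)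
      (𝓝 (2 * Real.log c)) := by
    intro c hc
    have : ContinuousAt (fun ε : ℝ => Real.log (c ^ 2 + ε ^ 2)) 0 :=
      ContinuousAt.log (by fun_prop) (by positivity)
    have h := this.tendsto.mono_left (nhdsWithin_le_nhds (s := Ioi 0))
    simpa using h
  have h3 := h1.add ((((h2 _ hd).sub (h2 (t ^ 2) (by positivity))).div_const 4).const_mul (M t))
  refine (h3.congr' ?_).trans (le_of_eq ?_)
  · filter_upwards [self_mem_nhdsWithin] with ε hε
    exact (integral_regInv_split hMc hε).symm
  · rw [pvClosedForm]
    congr 2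
    ring

/-- A bound for the regularized integrals that does not depend on `ε`. -/
theorem abs_integral_regInv_le {M : ℝ → ℝ} {L : NNReal} (hM : LipschitzWith L M) {A t ε : ℝ}
    (ht : 0 < t) (htA : t < A) (hε : 0 < ε) :
    |∫ s in (0 : ℝ)..A, s * M s * regInv ε (s ^ 2 - t ^ 2)|
      ≤ L * A + |M t| * (|Real.log (A ^ 2 - t ^ 2) - Real.log (t ^ 2)| / 2) := by
  have hd : 0 < A ^ 2 - t ^ 2 := by nlinarith
  -- Adding the same `ε²` to both arguments brings their quotient closer to `1`.
  have key : ∀ a b : ℝ, 0 < a → a ≤ b →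
      |Real.log (b ^ 2 + ε ^ 2) - Real.log (a ^ 2 + ε ^ 2)| ≤ 2 * |Real.log b - Real.log a| := by
    intro a b ha hab
    have hb : 0 < b := by linarith
    have hsq : a ^ 2 ≤ b ^ 2 := by gcongr
    have h1 : Real.log (a ^ 2 + ε ^ 2) ≤ Real.log (b ^ 2 + ε ^ 2) :=
      Real.log_le_log (by positivity) (by linarith)
    have h2 : Real.log a ≤ Real.log b := Real.log_le_log ha hab
    rw [abs_of_nonneg (by linarith), abs_of_nonneg (by linarith)]
    have h3 : Real.log ((b ^ 2 + ε ^ 2) * a ^ 2) ≤ Real.log ((a ^ 2 + ε ^ 2) * b ^ 2) := by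
      refine Real.log_le_log (by positivity) ?_
      nlinarith [sq_nonneg ε]
    rw [Real.log_mul (by positivity) (by positivity), Real.log_mul (by positivity) (by positivity),
      Real.log_pow, Real.log_pow] at h3
    push_cast at h3
    linarith
  have key' : |Real.log ((A ^ 2 - t ^ 2) ^ 2 + ε ^ 2) - Real.log ((t ^ 2) ^ 2 + ε ^ 2)|
      ≤ 2 * |Real.log (A ^ 2 - t ^ 2) - Real.log (t ^ 2)| := by
    rcases le_total (t ^ 2) (A ^ 2 - t ^ 2) with h | h
    · exact key _ _ (by positivity) h
    · have := key _ _ hd h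
      rwa [abs_sub_comm, abs_sub_comm (Real.log (t ^ 2))] at this
  rw [integral_regInv_split hM.continuous hε]
  refine (abs_add_le _ _).trans (add_le_add ?_ ?_)
  · have := intervalIntegral.norm_integral_le_of_norm_le_const (a := 0) (b := A) (C := L)
      (f := fun s => s * (M s - M t) * regInv ε (s ^ 2 - t ^ 2)) ?_
    · simpa [abs_of_pos (ht.trans htA)] using this
    · intro s hs
      rw [uIoc_of_le (by linarith)] at hs
      rw [norm_mul, Real.norm_eq_abs, Real.norm_eq_abs]
      exact (mul_le_mul_of_nonneg_left (abs_regInv_le _ _) (abs_nonneg _)).trans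
        (abs_mul_sub_mul_inv_le hM hs.1.le ht)
  · rw [abs_mul, abs_div, abs_of_pos (by norm_num : (0 : ℝ) < 4)]
    gcongr ?_ * ?_
    linarith

theorem measurableSet_punctured (a b c ε : ℝ) : MeasurableSet (punctured a b c ε) :=
  measurableSet_Icc.inter
    (measurableSet_lt measurable_const (by fun_prop : Measurable fun t : ℝ => |t - c|))

theorem continuousOn_inv_sq_sub_sq {t : ℝ} (ht : 0 < t) {s : Set ℝ} (hs : ∀ x ∈ s, 0 ≤ x ∧ x ≠ t) :
    ContinuousOn (fun x : ℝ => (x ^ 2 - t ^ 2)⁻¹) s := by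
  refine ContinuousOn.inv₀ (by fun_prop) fun x hx h => ?_
  have h1 : (x - t) * (x + t) = 0 := by linarith
  rcases mul_eq_zero.mp h1 with h2 | h2
  · exact (hs x hx).2 (by linarith)
  · linarith [(hs x hx).1]

theorem integrableOn_punctured {G : ℝ → ℝ} (hG : Continuous G) {A t ε : ℝ} (ht : 0 < t)
    (hε : 0 < ε) : IntegrableOn (fun s => G s * (s ^ 2 - t ^ 2)⁻¹) (punctured 0 A t ε) := by
  have hK : IsCompact (Icc 0 A ∩ {s : ℝ | ε ≤ |s - t|}) :=
    isCompact_Icc.inter_right (isClosed_le continuous_const (by fun_prop))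
  refine IntegrableOn.mono_set (ContinuousOn.integrableOn_compact hK ?_)
    fun s hs => ⟨hs.1, hs.2.le⟩
  refine hG.continuousOn.mul (continuousOn_inv_sq_sub_sq ht fun s hs => ⟨hs.1.1, ?_⟩)
  rintro rfl
  have := hs.2
  simp at this
  linarith

theorem punctured_eq_union {A t ε : ℝ} (hε : 0 < ε) (h1 : ε < t) (h2 : t + ε < A) :
    punctured 0 A t ε = Ico 0 (t - ε) ∪ Ioc (t + ε) A := by
  ext s
  simp only [punctured, mem_ofPred_eq, mem_Icc, mem_union, mem_Ico, mem_Ioc, lt_abs]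
  constructor
  · rintro ⟨⟨ha, hb⟩, h | h⟩
    · right; constructor <;> linarith
    · left; constructor <;> linarith
  · rintro (⟨ha, hb⟩ | ⟨ha, hb⟩)
    · refine ⟨⟨ha, by linarith⟩, Or.inr (by linarith)⟩
    · refine ⟨⟨by linarith, hb⟩, Or.inl (by linarith)⟩

theorem integral_mul_inv_sq_sub_sq {a b t : ℝ} (ht : 0 < t) (hab : ∀ x ∈ uIcc a b, 0 ≤ x ∧ x ≠ t) :
    ∫ s in a..b, s * (s ^ 2 - t ^ 2)⁻¹
      = (Real.log (b ^ 2 - t ^ 2) - Real.log (a ^ 2 - t ^ 2)) / 2 := by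
  have hd : ∀ s ∈ uIcc a b, HasDerivAt (fun s => Real.log (s ^ 2 - t ^ 2) / 2)
      (s * (s ^ 2 - t ^ 2)⁻¹) s := by
    intro s hs
    have h0 : s ^ 2 - t ^ 2 ≠ 0 := by
      rw [show s ^ 2 - t ^ 2 = (s - t) * (s + t) by ring]
      have := hab s hs
      exact mul_ne_zero (sub_ne_zero.mpr this.2) (by linarith [this.1])
    have h1 := ((((hasDerivAt_id s).pow 2).sub_const (t ^ 2)).log h0).div_const 2
    refine h1.congr_deriv ?_
    simp only [id, Nat.cast_ofNat, Pi.pow_apply]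
    field_simp
    simp
  have hc : ContinuousOn (fun s => s * (s ^ 2 - t ^ 2)⁻¹) (uIcc a b) :=
    continuousOn_id.mul (continuousOn_inv_sq_sub_sq ht hab)
  rw [intervalIntegral.integral_eq_sub_of_hasDerivAt hd hc.intervalIntegrable]
  ring

/-- The logarithmic divergences on the two sides of `t` cancel because the excluded interval is
symmetric. -/
theorem setIntegral_punctured_mul_inv {A t ε : ℝ} (hε : 0 < ε) (h1 : ε < t) (h2 : t + ε < A) :
    ∫ s in punctured 0 A t ε, s * (s ^ 2 - t ^ 2)⁻¹
      = (Real.log (2 * t - ε) - Real.log (2 * t + ε)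
        + (Real.log (A ^ 2 - t ^ 2) - Real.log (t ^ 2))) / 2 := by
  have ht : 0 < t := hε.trans h1
  have hint := integrableOn_punctured continuous_id (A := A) ht hε
  simp only [id] at hint
  rw [punctured_eq_union hε h1 h2] at hint ⊢
  have hdisj : Disjoint (Ico 0 (t - ε)) (Ioc (t + ε) A) := by
    rw [Set.disjoint_left]
    intro x hx hx'
    linarith [hx.2, hx'.1]
  rw [setIntegral_union hdisj measurableSet_Ioc (hint.mono_set subset_union_left)
    (hint.mono_set subset_union_right), ← intervalIntegral.integral_of_le h2.le,
    integral_Ico_eq_integral_Ioc, ← intervalIntegral.integral_of_le (by linarith),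
    integral_mul_inv_sq_sub_sq ht, integral_mul_inv_sq_sub_sq ht]
  · rw [show (t - ε) ^ 2 - t ^ 2 = -(ε * (2 * t - ε)) by ring,
      show (0 : ℝ) ^ 2 - t ^ 2 = -(t ^ 2) by ring,
      show (t + ε) ^ 2 - t ^ 2 = ε * (2 * t + ε) by ring, Real.log_neg_eq_log, Real.log_neg_eq_log,
      Real.log_mul hε.ne' (by linarith), Real.log_mul hε.ne' (by linarith)]
    ring
  · intro x hx
    rw [uIcc_of_le h2.le] at hx
    exact ⟨by linarith [hx.1], by linarith [hx.1]⟩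
  · intro x hx
    rw [uIcc_of_le (by linarith)] at hx
    exact ⟨hx.1, by linarith [hx.2]⟩

theorem hasPrincipalValue_pvClosedForm {M : ℝ → ℝ} {L : NNReal} (hM : LipschitzWith L M) {A t : ℝ}
    (ht : 0 < t) (htA : t < A) :
    HasPrincipalValue (fun s => s * M s * (1 / (s ^ 2 - t ^ 2))) 0 A t (pvClosedForm M A t) := by
  have hMc := hM.continuous
  simp only [one_div]
  refine ⟨fun ε hε => integrableOn_punctured (G := fun s => s * M s) (by fun_prop) ht hε, ?_⟩
  have h1 : Tendsto (fun ε => ∫ s in punctured 0 A t ε, s * (M s - M t) * (s ^ 2 - t ^ 2)⁻¹)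
      (𝓝[>] 0) (𝓝 (∫ s in (0 : ℝ)..A, s * (M s - M t) * (s ^ 2 - t ^ 2)⁻¹)) := by
    rw [intervalIntegral.integral_of_le (by linarith), ← integral_Icc_eq_integral_Ioc]
    simp_rw [← integral_indicator (measurableSet_punctured _ _ _ _)]
    rw [← integral_indicator measurableSet_Icc]
    refine tendsto_integral_filter_of_dominated_convergence
      ((Icc (0 : ℝ) A).indicator fun _ => (L : ℝ)) ?_ ?_ ?_ ?_
    · filter_upwards [self_mem_nhdsWithin] with ε hε
      exact (integrable_indicator_iff (measurableSet_punctured _ _ _ _)).mpr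
        (integrableOn_punctured (G := fun s => s * (M s - M t)) (by fun_prop) ht hε)
        |>.aestronglyMeasurable
    · refine Eventually.of_forall fun ε => Eventually.of_forall fun s => ?_
      by_cases hs : s ∈ punctured 0 A t ε
      · rw [indicator_of_mem hs, indicator_of_mem hs.1, norm_mul, norm_inv, Real.norm_eq_abs,
          Real.norm_eq_abs]
        exact abs_mul_sub_mul_inv_le hM hs.1.1 ht
      · rw [indicator_of_notMem hs, norm_zero]
        exact indicator_nonneg (fun _ _ => L.2) _
    · exact (integrable_indicator_iff measurableSet_Icc).mpr
        (integrableOn_const (by simp))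
    · have hne : ∀ᵐ s : ℝ, s ≠ t := by simp [ae_iff]
      filter_upwards [hne] with s hs
      refine tendsto_const_nhds.congr' ?_
      have hpos : 0 < |s - t| := abs_pos.mpr (sub_ne_zero.mpr hs)
      filter_upwards [Ioo_mem_nhdsGT hpos] with ε hε
      by_cases hs' : s ∈ Icc 0 A
      · rw [indicator_of_mem hs', indicator_of_mem (show s ∈ punctured 0 A t ε from ⟨hs', hε.2⟩)]
      · rw [indicator_of_notMem hs', indicator_of_notMem fun h => hs' h.1]
  have h2 : Tendsto (fun ε : ℝ => M t * ((Real.log (2 * t - ε) - Real.log (2 * t + ε)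
        + (Real.log (A ^ 2 - t ^ 2) - Real.log (t ^ 2))) / 2)) (𝓝[>] 0)
      (𝓝 (M t * ((Real.log (A ^ 2 - t ^ 2) - Real.log (t ^ 2)) / 2))) := by
    have hc : ContinuousAt (fun ε : ℝ => M t * ((Real.log (2 * t - ε) - Real.log (2 * t + ε)
        + (Real.log (A ^ 2 - t ^ 2) - Real.log (t ^ 2))) / 2)) 0 := by
      have ha : ContinuousAt (fun ε : ℝ => Real.log (2 * t - ε)) 0 :=
        ContinuousAt.log (by fun_prop) (by simpa using ht.ne')
      have hb : ContinuousAt (fun ε : ℝ => Real.log (2 * t + ε)) 0 :=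
        ContinuousAt.log (by fun_prop) (by simpa using ht.ne')
      fun_prop
    have h := hc.tendsto.mono_left (nhdsWithin_le_nhds (s := Ioi 0))
    simpa using h
  refine (h1.add h2).congr' ?_
  filter_upwards [Ioo_mem_nhdsGT (lt_min ht (sub_pos.mpr htA))] with ε hε
  have hε1 : ε < t := hε.2.trans_le (min_le_left _ _)
  have hε2 : t + ε < A := by linarith [hε.2.trans_le (min_le_right t (A - t))]
  rw [← setIntegral_punctured_mul_inv hε.1 hε1 hε2, ← integral_const_mul, ← integral_add]
  · refine setIntegral_congr_fun (measurableSet_punctured _ _ _ _) fun s _ => ?_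
    ring
  · exact integrableOn_punctured (G := fun s => s * (M s - M t)) (by fun_prop) ht hε.1
  · exact (integrableOn_punctured (G := fun s => s) continuous_id ht hε.1).const_mul _

theorem principalValue_eq {M : ℝ → ℝ} {L : NNReal} (hM : LipschitzWith L M) {A t : ℝ}
    (ht : 0 < t) (htA : t < A) :
    principalValue (fun s => s * M s * (1 / (s ^ 2 - t ^ 2))) 0 A t = pvClosedForm M A t :=
  (hasPrincipalValue_pvClosedForm hM ht htA).2.limUnder_eq

/-! ### The resolvent of the cosine -/

/-- The integral of `1 / (w - R cos φ)` over a period, for `w` off the real axis. -/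
def cosResolvent (R : ℝ) (w : ℂ) : ℂ :=
  ∫ φ in (0 : ℝ)..(2 * Real.pi), (w - (R * Real.cos φ : ℝ))⁻¹

theorem sub_ofReal_ne_zero {w : ℂ} (hw : w.im ≠ 0) (x : ℝ) : w - (x : ℂ) ≠ 0 := by
  intro h
  apply hw
  simpa using congrArg Complex.im h

/-- The mean value property of `ζ ↦ 1 / (1 - q ζ)` on the unit circle. -/
theorem integral_inv_one_sub_mul_circleMap {q : ℂ} (hq : ‖q‖ < 1) :
    ∫ φ in (0 : ℝ)..(2 * Real.pi), (1 - q * circleMap 0 1 φ)⁻¹ = 2 * Real.pi := by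
  have hd : DiffContOnCl ℂ (fun ζ : ℂ => (1 - q * ζ)⁻¹) (Metric.ball 0 |1|) := by
    refine DifferentiableOn.diffContOnCl fun ζ hζ => ?_
    rw [abs_one, closure_ball _ one_ne_zero, mem_closedBall_zero_iff] at hζ
    refine (DifferentiableAt.inv (by fun_prop) fun h => ?_).differentiableWithinAt
    have h1 : q * ζ = 1 := (sub_eq_zero.mp h).symm
    have h2 : ‖q‖ * ‖ζ‖ = 1 := by rw [← norm_mul, h1, norm_one]
    nlinarith [norm_nonneg q]
  have h := hd.circleAverage
  rw [Real.circleAverage] at h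
  simp only [mul_zero, sub_zero, inv_one] at h
  rw [inv_smul_eq_iff₀ (by positivity)] at h
  rw [h]
  simp

theorem circleMap_mul_circleMap_neg (φ : ℝ) : circleMap 0 1 φ * circleMap 0 1 (-φ) = 1 := by
  simp only [circleMap, Complex.ofReal_one, one_mul, zero_add, ← Complex.exp_add]
  simp

theorem circleMap_add_neg (φ : ℝ) :
    circleMap 0 1 φ + circleMap 0 1 (-φ) = 2 * (Real.cos φ : ℝ) := by
  simp [circleMap, Complex.cos]
  ring

/-- The resolvent of the cosine is a square root of `4π² / (w² - R²)`. The substitution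
`w = R (q + 1/q) / 2` with `|q| < 1` splits the integrand into two geometric series. -/
theorem cosResolvent_sq_mul {R : ℝ} (hR : 0 < R) {w : ℂ} (hw : w.im ≠ 0) :
    cosResolvent R w ^ 2 * (w ^ 2 - (R : ℂ) ^ 2) = 4 * (Real.pi : ℂ) ^ 2 := by
  have hRc : (R : ℂ) ≠ 0 := by exact_mod_cast hR.ne'
  obtain ⟨q, hq1, hq⟩ : ∃ q : ℂ, ‖q‖ < 1 ∧ R * (q ^ 2 + 1) = 2 * w * q := by
    obtain ⟨d, hd⟩ := IsAlgClosed.exists_pow_nat_eq (w ^ 2 - (R : ℂ) ^ 2) (n := 2) (by norm_num)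
    have hprod : (w + d) / R * ((w - d) / R) = 1 := by
      field_simp
      linear_combination -hd
    have hroot : ∀ q : ℂ, (q = (w + d) / R ∨ q = (w - d) / R) → R * (q ^ 2 + 1) = 2 * w * q := by
      rintro q (rfl | rfl)
      · field_simp
        linear_combination hd
      · field_simp
        linear_combination hd
    -- A root of modulus one would give `w = R Re q`.
    have hne : ‖(w + d) / R‖ ≠ 1 := by
      intro h1
      have hr := hroot _ (Or.inl rfl)
      set q := (w + d) / R
      have hqc : q * (starRingEnd ℂ) q = 1 := by
        rw [Complex.mul_conj, Complex.normSq_eq_norm_sq, h1]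
        simp
      have h2 : w = ((R * q.re : ℝ) : ℂ) := by
        have h3 := Complex.add_conj q
        push_cast at h3 ⊢
        have h0 : q ≠ 0 := left_ne_zero_of_mul_eq_one hqc
        have : 2 * q * w = 2 * q * (R * q.re) := by
          linear_combination (-1 : ℂ) * hr + R * (-1 : ℂ) * hqc + R * q * h3
        exact mul_left_cancel₀ (mul_ne_zero two_ne_zero h0) this
      exact hw (by rw [h2, Complex.ofReal_im])
    have hn : ‖(w + d) / R‖ * ‖(w - d) / R‖ = 1 := by rw [← norm_mul, hprod, norm_one]
    rcases lt_or_gt_of_ne hne with h | h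
    · exact ⟨_, h, hroot _ (Or.inl rfl)⟩
    · refine ⟨_, ?_, hroot _ (Or.inr rfl)⟩
      by_contra hle
      nlinarith
  have hq0 : q ≠ 0 := by
    rintro rfl
    simp [hRc] at hq
  have hq2 : 1 - q ^ 2 ≠ 0 := by
    intro h
    have h1 : q ^ 2 = 1 := (sub_eq_zero.mp h).symm
    have h2 : ‖q‖ ^ 2 = 1 := by rw [← norm_pow, h1, norm_one]
    nlinarith [norm_nonneg q]
  have hfac : ∀ φ : ℝ, 1 - q * circleMap 0 1 φ ≠ 0 := by
    intro φ h
    have h1 : q * circleMap 0 1 φ = 1 := (sub_eq_zero.mp h).symm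
    have h2 : ‖q‖ = 1 := by simpa using congrArg norm h1
    linarith
  have hpt : ∀ φ : ℝ, (w - (R * Real.cos φ : ℝ))⁻¹ = 2 * q / (R * (1 - q ^ 2))
      * ((1 - q * circleMap 0 1 φ)⁻¹ + (1 - q * circleMap 0 1 (-φ))⁻¹ - 1) := by
    intro φ
    have h1 := circleMap_mul_circleMap_neg φ
    have h2 := circleMap_add_neg φ
    have h3 := hfac φ
    have h4 := hfac (-φ)
    have h5 := sub_ofReal_ne_zero hw (R * Real.cos φ)
    push_cast at h2 h5 ⊢
    generalize circleMap 0 1 φ = a at *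
    generalize circleMap 0 1 (-φ) = b at *
    have h6 : 2 * q * (w - R * Complex.cos φ) = R * ((1 - q * a) * (1 - q * b)) := by
      linear_combination (-1 : ℂ) * hq + R * q * h2 - R * q ^ 2 * h1
    have h7 : (1 - q * a)⁻¹ + (1 - q * b)⁻¹ - 1 = (1 - q ^ 2) / ((1 - q * a) * (1 - q * b)) := by
      field_simp
      linear_combination (-q ^ 2) * h1
    rw [h7, inv_eq_one_div, div_mul_div_comm, div_eq_div_iff h5 (by positivity)]
    linear_combination (-(1 - q ^ 2)) * h6
  have hcont : Continuous fun φ : ℝ => (1 - q * circleMap 0 1 φ)⁻¹ :=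
    Continuous.inv₀ (by fun_prop) hfac
  have hcont' : Continuous fun φ : ℝ => (1 - q * circleMap 0 1 (-φ))⁻¹ := hcont.comp continuous_neg
  have hI := integral_inv_one_sub_mul_circleMap hq1
  have hI' : ∫ φ in (0 : ℝ)..(2 * Real.pi), (1 - q * circleMap 0 1 (-φ))⁻¹ = 2 * Real.pi := by
    rw [intervalIntegral.integral_comp_neg (fun φ => (1 - q * circleMap 0 1 φ)⁻¹), ← hI]
    have hper : Function.Periodic (fun φ => (1 - q * circleMap 0 1 φ)⁻¹) (2 * Real.pi) := by
      intro φ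
      simp only [periodic_circleMap 0 1 φ]
    have := hper.intervalIntegral_add_eq (-(2 * Real.pi)) 0
    simpa using this
  have hZ : cosResolvent R w = 2 * q / (R * (1 - q ^ 2)) * (2 * Real.pi) := by
    rw [cosResolvent, intervalIntegral.integral_congr fun φ _ => hpt φ,
      intervalIntegral.integral_const_mul, intervalIntegral.integral_sub,
      intervalIntegral.integral_add, hI, hI', intervalIntegral.integral_const]
    · simp
    · exact hcont.intervalIntegrable _ _
    · exact hcont'.intervalIntegrable _ _
    · exact (hcont.add hcont').intervalIntegrable _ _
    · exact intervalIntegrable_const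
  have hw2 : 4 * q ^ 2 * (w ^ 2 - (R : ℂ) ^ 2) = R ^ 2 * (1 - q ^ 2) ^ 2 := by
    linear_combination (-(2 * w * q) - R * (q ^ 2 + 1)) * hq
  have hwe : w ^ 2 - (R : ℂ) ^ 2 = R ^ 2 * (1 - q ^ 2) ^ 2 / (4 * q ^ 2) := by
    rw [← hw2]
    field_simp
  rw [hZ, hwe]
  field_simp
  ring

theorem norm_cosResolvent_le {R s η : ℝ} (hs : |s| < R) (hη : 0 < η) :
    ‖cosResolvent R (s + η * Complex.I)‖ ≤ 2 * Real.pi / (R - |s|) := by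
  have hR : 0 < R := (abs_nonneg s).trans_lt hs
  set w : ℂ := s + η * Complex.I with hw
  have hre : w.re = s := by simp [hw]
  have him : w.im ≠ 0 := by simp [hw, hη.ne']
  have h := congrArg norm (cosResolvent_sq_mul hR him)
  rw [show w ^ 2 - (R : ℂ) ^ 2 = (w - R) * (w + R) by ring, norm_mul, norm_mul, norm_pow] at h
  have h1 : R - |s| ≤ ‖w - R‖ := by
    refine le_trans ?_ (Complex.abs_re_le_norm _)
    rw [Complex.sub_re, Complex.ofReal_re, hre, abs_sub_comm]
    exact (sub_le_sub_left (le_abs_self s) R).trans (le_abs_self _)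
  have h2 : R - |s| ≤ ‖w + R‖ := by
    refine le_trans ?_ (Complex.abs_re_le_norm _)
    rw [Complex.add_re, Complex.ofReal_re, hre]
    exact le_trans (by linarith [neg_abs_le s]) (le_abs_self _)
  have h3 : ‖(4 : ℂ) * (Real.pi : ℂ) ^ 2‖ = (2 * Real.pi) ^ 2 := by
    simp [abs_of_pos Real.pi_pos]
    ring
  have h0 : 0 < R - |s| := by linarith
  rw [h3] at h
  rw [le_div_iff₀ h0]
  refine le_of_sq_le_sq ?_ (by positivity)
  rw [mul_pow, ← h]
  gcongr
  rw [sq]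
  gcongr

/-- On the interval `(-R, R)` the boundary values of the resolvent are purely imaginary; hence the
principal value of `∫ dφ / (s - R cos φ)` vanishes. -/
theorem tendsto_re_cosResolvent {R s : ℝ} (hs : |s| < R) :
    Tendsto (fun η : ℝ => (cosResolvent R (s + η * Complex.I)).re) (𝓝[>] 0) (𝓝 0) := by
  have hR : 0 < R := (abs_nonneg s).trans_lt hs
  have hs2 : s ^ 2 < R ^ 2 := sq_lt_sq' (by linarith [neg_abs_le s]) ((le_abs_self s).trans_lt hs)
  set Q : ℝ → ℂ := fun η => 4 * (Real.pi : ℂ) ^ 2 / ((s + η * Complex.I) ^ 2 - (R : ℂ) ^ 2) with hQ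
  have hQ0 : Q 0 = ((4 * Real.pi ^ 2 / (s ^ 2 - R ^ 2) : ℝ) : ℂ) := by
    simp [hQ]
  have hden : ((s : ℂ) + (0 : ℝ) * Complex.I) ^ 2 - (R : ℂ) ^ 2 ≠ 0 := by
    have : s ^ 2 - R ^ 2 ≠ 0 := by linarith
    simp only [Complex.ofReal_zero, zero_mul, add_zero]
    exact_mod_cast this
  have hc : ContinuousAt Q 0 :=
    ContinuousAt.div (by fun_prop) (by fun_prop) hden
  have hlim : Tendsto (fun η => (‖Q η‖ + (Q η).re) / 2) (𝓝[>] 0) (𝓝 0) := by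
    have h1 : ContinuousAt (fun η => (‖Q η‖ + (Q η).re) / 2) 0 :=
      (hc.norm.add (Complex.continuous_re.continuousAt.comp hc)).div_const 2
    have h2 := h1.tendsto.mono_left (nhdsWithin_le_nhds (s := Ioi 0))
    have h3 : (‖Q 0‖ + (Q 0).re) / 2 = 0 := by
      rw [hQ0, Complex.norm_real, Complex.ofReal_re, Real.norm_eq_abs, abs_of_nonpos]
      · ring
      · exact div_nonpos_of_nonneg_of_nonpos (by positivity) (by linarith)
    rwa [h3] at h2
  have hsq : Tendsto (fun η : ℝ => (cosResolvent R (s + η * Complex.I)).re ^ 2) (𝓝[>] 0) (𝓝 0) := by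
    refine hlim.congr' ?_
    filter_upwards [self_mem_nhdsWithin] with η hη
    have him : ((s : ℂ) + η * Complex.I).im ≠ 0 := by
      simpa using (show (0 : ℝ) < η from hη).ne'
    have h := cosResolvent_sq_mul hR him
    have hne : ((s : ℂ) + η * Complex.I) ^ 2 - (R : ℂ) ^ 2 ≠ 0 := by
      intro h0
      rw [h0, mul_zero] at h
      have : (Real.pi : ℂ) ≠ 0 := by exact_mod_cast Real.pi_ne_zero
      exact mul_ne_zero (by norm_num) (pow_ne_zero 2 this) h.symm
    have hZ : Q η = cosResolvent R (s + η * Complex.I) ^ 2 := by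
      simp only [hQ]
      rw [← h, mul_div_assoc, div_self hne, mul_one]
    rw [hZ, norm_pow, ← Complex.normSq_eq_norm_sq, Complex.normSq_apply, sq, sq, Complex.mul_re]
    ring
  have h := hsq.sqrt
  simp only [Real.sqrt_sq_eq_abs, Real.sqrt_zero] at h
  exact (tendsto_zero_iff_abs_tendsto_zero _).mpr h

theorem re_inv_add_mul_I (σ η : ℝ) : ((σ : ℂ) + η * Complex.I)⁻¹.re = regInv η σ := by
  simp [Complex.inv_re, Complex.normSq_apply, regInv, sq]

theorem integral_regInv_sub_cos {R s η : ℝ} (hη : 0 < η) :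
    ∫ φ in (0 : ℝ)..(2 * Real.pi), regInv η (s - R * Real.cos φ)
      = (cosResolvent R (s + η * Complex.I)).re := by
  have him : ((s : ℂ) + η * Complex.I).im ≠ 0 := by simpa using hη.ne'
  have hcont : Continuous fun φ : ℝ => ((s : ℂ) + η * Complex.I - (R * Real.cos φ : ℝ))⁻¹ :=
    Continuous.inv₀ (by fun_prop) fun φ => sub_ofReal_ne_zero him _
  have h := Complex.reCLM.intervalIntegral_comp_comm (hcont.intervalIntegrable (μ := volume) 0
    (2 * Real.pi))
  rw [cosResolvent]
  refine Eq.trans ?_ h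
  refine intervalIntegral.integral_congr fun φ _ => ?_
  simp only [Complex.reCLM_apply]
  rw [← re_inv_add_mul_I]
  push_cast
  congr 2
  ring

/-- The radial part of the regularized backprojection kernel. -/
def cosMoment (R s η : ℝ) : ℝ :=
  ∫ φ in (0 : ℝ)..(2 * Real.pi), R * Real.cos φ * regInv η (s - R * Real.cos φ)

/-- Writing `R cos φ = s - (s - R cos φ)` reduces the moment to the resolvent. -/
theorem cosMoment_eq {R s η : ℝ} (hη : 0 < η) :
    cosMoment R s η = s * (cosResolvent R (s + η * Complex.I)).re
      - ∫ φ in (0 : ℝ)..(2 * Real.pi), (s - R * Real.cos φ) * regInv η (s - R * Real.cos φ) := by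
  have hk : Continuous fun φ => regInv η (s - R * Real.cos φ) :=
    (continuous_regInv hη).comp (by fun_prop)
  rw [← integral_regInv_sub_cos hη, ← intervalIntegral.integral_const_mul,
    ← intervalIntegral.integral_sub, cosMoment]
  · refine intervalIntegral.integral_congr fun φ _ => ?_
    ring
  · exact Continuous.intervalIntegrable (by fun_prop) _ _
  · exact Continuous.intervalIntegrable (by fun_prop) _ _

theorem abs_mul_regInv_le_one (σ η : ℝ) : |σ * regInv η σ| ≤ 1 := by
  rw [abs_mul]
  exact (mul_le_mul_of_nonneg_left (abs_regInv_le η σ) (abs_nonneg σ)).trans (mul_inv_le_one)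

theorem abs_cosMoment_le {R s η : ℝ} (hs : |s| < R) (hη : 0 < η) :
    |cosMoment R s η| ≤ |s| * (2 * Real.pi / (R - |s|)) + 2 * Real.pi := by
  rw [cosMoment_eq hη]
  refine (abs_sub _ _).trans (add_le_add ?_ ?_)
  · rw [abs_mul]
    gcongr
    exact (Complex.abs_re_le_norm _).trans (norm_cosResolvent_le hs hη)
  · have := intervalIntegral.norm_integral_le_of_norm_le_const (a := 0) (b := 2 * Real.pi) (C := 1)
      (f := fun φ => (s - R * Real.cos φ) * regInv η (s - R * Real.cos φ))
      fun φ _ => abs_mul_regInv_le_one _ _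
    simpa [abs_of_pos Real.pi_pos] using this

theorem tendsto_cosMoment {R s : ℝ} (hs : |s| < R) :
    Tendsto (cosMoment R s) (𝓝[>] 0) (𝓝 (-(2 * Real.pi))) := by
  have hR : 0 < R := (abs_nonneg s).trans_lt hs
  have h1 : Tendsto (fun η => ∫ φ in (0 : ℝ)..(2 * Real.pi),
      (s - R * Real.cos φ) * regInv η (s - R * Real.cos φ)) (𝓝[>] 0)
      (𝓝 (∫ _ in (0 : ℝ)..(2 * Real.pi), (1 : ℝ))) := by
    refine intervalIntegral.tendsto_integral_filter_of_dominated_convergence (fun _ => (1 : ℝ))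
      ?_ ?_ (by simp) ?_
    · filter_upwards [self_mem_nhdsWithin] with η hη
      have hk : Continuous fun φ => regInv η (s - R * Real.cos φ) :=
        (continuous_regInv hη).comp (by fun_prop)
      exact Continuous.aestronglyMeasurable (by fun_prop)
    · exact Eventually.of_forall fun η => Eventually.of_forall fun φ _ => abs_mul_regInv_le_one _ _
    · -- On `(0, 2π]` the equation `R cos φ = s` has at most two solutions.
      have hfin : ({Real.arccos (s / R), 2 * Real.pi - Real.arccos (s / R)} : Set ℝ).Finite :=
        Set.toFinite _
      filter_upwards [hfin.measure_zero volume |> compl_mem_ae_iff.mpr] with φ hφ hφ'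
      rw [uIoc_of_le (by positivity)] at hφ'
      have hne : s - R * Real.cos φ ≠ 0 := by
        intro h
        have hcos : s / R = Real.cos φ := by
          field_simp
          linarith
        apply hφ
        rw [hcos]
        rcases le_total φ Real.pi with hle | hle
        · left
          rw [Real.arccos_cos hφ'.1.le hle]
        · right
          rw [← Real.cos_two_pi_sub, Real.arccos_cos (by linarith [hφ'.2]) (by linarith)]
          simp
      have := (tendsto_regInv (s - R * Real.cos φ)).const_mul (s - R * Real.cos φ)
      rwa [mul_inv_cancel₀ hne] at this
  have h2 := ((tendsto_re_cosResolvent hs).const_mul s).sub h1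
  rw [show s * 0 - ∫ _ in (0 : ℝ)..(2 * Real.pi), (1 : ℝ) = -(2 * Real.pi) by simp] at h2
  refine h2.congr' ?_
  filter_upwards [self_mem_nhdsWithin] with η hη
  exact (cosMoment_eq hη).symm

/-! ### The regularized backprojection kernel -/

theorem exists_eq_norm_smul_unitVec (v : Plane) : ∃ α : ℝ, v = ‖v‖ • unitVec α := by
  set c : ℂ := ⟨v 0, v 1⟩ with hc
  have hn : ‖v‖ = ‖c‖ := by
    rw [EuclideanSpace.norm_eq, Complex.norm_def, Complex.normSq_apply]
    simp [hc, sq]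
  refine ⟨c.arg, ?_⟩
  rw [hn]
  ext i
  fin_cases i
  · simp [unitVec, hc]
  · simp [unitVec, hc]

theorem inner_unitVec (α θ : ℝ) : inner ℝ (unitVec α) (unitVec θ) = Real.cos (θ - α) := by
  simp [unitVec, PiLp.inner_apply, Real.cos_sub]

theorem unitVec_add (φ α : ℝ) : unitVec (φ + α)
    = Real.cos φ • unitVec α + Real.sin φ • unitVec (α + Real.pi / 2) := by
  ext i
  fin_cases i <;> simp [unitVec, Real.cos_add, Real.sin_add]
  · ring
  · ring

theorem regInv_mul {c : ℝ} (hc : 0 < c) (ε τ : ℝ) :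
    regInv ε (c * τ) = c⁻¹ * regInv (ε / c) τ := by
  have h : (c * τ) ^ 2 + ε ^ 2 = c ^ 2 * (τ ^ 2 + (ε / c) ^ 2) := by
    field_simp
  rw [regInv, regInv, h]
  field_simp

/-- The power difference of `x` and `y` with respect to a point of the circle is affine in the
cosine of the polar angle measured from the direction of `x - y`. -/
theorem norm_sq_sub_norm_sq {R α : ℝ} {x y : Plane} (hxy : x ≠ y)
    (hα : x - y = ‖x - y‖ • unitVec α) (θ : ℝ) :
    ‖x - R • unitVec θ‖ ^ 2 - ‖y - R • unitVec θ‖ ^ 2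
      = 2 * ‖x - y‖ * ((‖x‖ ^ 2 - ‖y‖ ^ 2) / (2 * ‖x - y‖) - R * Real.cos (θ - α)) := by
  have hr : ‖x - y‖ ≠ 0 := norm_ne_zero_iff.mpr (sub_ne_zero.mpr hxy)
  have h1 : inner ℝ x (unitVec θ) - inner ℝ y (unitVec θ) = ‖x - y‖ * Real.cos (θ - α) := by
    rw [← inner_sub_left]
    conv_lhs => rw [hα]
    rw [real_inner_smul_left, inner_unitVec]
  rw [norm_sub_sq_real, norm_sub_sq_real, real_inner_smul_right, real_inner_smul_right, mul_sub,
    mul_div_cancel₀ _ (by positivity)]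
  linear_combination (-2 * R) * h1

theorem integral_sin_mul_comp_cos {G : ℝ → ℝ} :
    ∫ φ in (0 : ℝ)..(2 * Real.pi), Real.sin φ * G (Real.cos φ) = 0 := by
  have h := intervalIntegral.integral_comp_sub_left (a := 0) (b := 2 * Real.pi)
    (fun φ => Real.sin φ * G (Real.cos φ)) (2 * Real.pi)
  simp only [Real.sin_two_pi_sub, Real.cos_two_pi_sub, sub_self, sub_zero, neg_mul,
    intervalIntegral.integral_neg] at h
  linarith

theorem integral_regInv_smul_unitVec {R ε : ℝ} (hε : 0 < ε) {x y : Plane} (hxy : x ≠ y) :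
    ∫ θ in (0 : ℝ)..(2 * Real.pi),
      (R * regInv ε (‖x - R • unitVec θ‖ ^ 2 - ‖y - R • unitVec θ‖ ^ 2)) • unitVec θ
    = (cosMoment R ((‖x‖ ^ 2 - ‖y‖ ^ 2) / (2 * ‖x - y‖)) (ε / (2 * ‖x - y‖))
        / (2 * ‖x - y‖ ^ 2)) • (x - y) := by
  obtain ⟨α, hα⟩ := exists_eq_norm_smul_unitVec (x - y)
  have hr : 0 < ‖x - y‖ := norm_pos_iff.mpr (sub_ne_zero.mpr hxy)
  set s := (‖x‖ ^ 2 - ‖y‖ ^ 2) / (2 * ‖x - y‖) with hs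
  set η := ε / (2 * ‖x - y‖) with hη
  have hη0 : 0 < η := by positivity
  set H : ℝ → Plane := fun θ =>
    (R * regInv ε (‖x - R • unitVec θ‖ ^ 2 - ‖y - R • unitVec θ‖ ^ 2)) • unitVec θ with hH
  have hper : Function.Periodic H (2 * Real.pi) := by
    intro θ
    simp only [hH, unitVec_periodic θ]
  have hshift : ∫ θ in (0 : ℝ)..(2 * Real.pi), H θ
      = ∫ φ in (0 : ℝ)..(2 * Real.pi), H (φ + α) := by
    rw [intervalIntegral.integral_comp_add_right, zero_add, add_comm (2 * Real.pi) α,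
      hper.intervalIntegral_add_eq α 0, zero_add]
  have hpt : ∀ φ, H (φ + α) = (2 * ‖x - y‖)⁻¹ • (R * Real.cos φ * regInv η (s - R * Real.cos φ))
        • unitVec α + ((2 * ‖x - y‖)⁻¹ * R) • (Real.sin φ * regInv η (s - R * Real.cos φ))
        • unitVec (α + Real.pi / 2) := by
    intro φ
    simp only [hH]
    rw [norm_sq_sub_norm_sq hxy hα, ← hs, add_sub_cancel_right, regInv_mul (by positivity), ← hη,
      unitVec_add]
    module
  have hk : Continuous fun φ => regInv η (s - R * Real.cos φ) :=
    (continuous_regInv hη0).comp (by fun_prop)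
  rw [hshift, intervalIntegral.integral_congr fun φ _ => hpt φ, intervalIntegral.integral_add,
    intervalIntegral.integral_smul, intervalIntegral.integral_smul,
    intervalIntegral.integral_smul_const, intervalIntegral.integral_smul_const,
    integral_sin_mul_comp_cos (G := fun c => regInv η (s - R * c)), zero_smul, smul_zero, add_zero,
    ← cosMoment]
  · conv_rhs => rw [hα]
    rw [smul_smul, smul_smul]
    congr 1
    simp only [norm_smul, norm_unitVec, norm_norm, mul_one]
    field_simp
  · exact Continuous.intervalIntegrable (by fun_prop) _ _
  · exact Continuous.intervalIntegrable (by fun_prop) _ _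

theorem abs_norm_sq_sub_div_le {x y : Plane} (hxy : x ≠ y) :
    |(‖x‖ ^ 2 - ‖y‖ ^ 2) / (2 * ‖x - y‖)| ≤ (‖x‖ + ‖y‖) / 2 := by
  have hr : 0 < ‖x - y‖ := norm_pos_iff.mpr (sub_ne_zero.mpr hxy)
  rw [abs_div, abs_of_pos (by positivity : 0 < 2 * ‖x - y‖), div_le_div_iff₀ (by positivity)
    (by norm_num), show ‖x‖ ^ 2 - ‖y‖ ^ 2 = (‖x‖ - ‖y‖) * (‖x‖ + ‖y‖) by ring, abs_mul,
    abs_of_nonneg (by positivity : 0 ≤ ‖x‖ + ‖y‖)]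
  have := mul_le_mul_of_nonneg_right (abs_norm_sub_norm_le x y)
    (by positivity : 0 ≤ ‖x‖ + ‖y‖)
  linarith

/-- The vector field `w / ‖w‖²`, the gradient of `log ‖w‖`, with value `0` at the origin. -/
def logGradient (w : Plane) : Plane := (‖w‖ ^ 2)⁻¹ • w

theorem norm_logGradient (w : Plane) : ‖logGradient w‖ = ‖w‖⁻¹ := by
  rcases eq_or_ne w 0 with rfl | hw
  · simp [logGradient]
  have : ‖w‖ ≠ 0 := norm_ne_zero_iff.mpr hw
  rw [logGradient, norm_smul, norm_inv, norm_pow, norm_norm]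
  field_simp

theorem locallyIntegrable_logGradient : LocallyIntegrable logGradient := by
  refine locallyIntegrable_of_norm_le_rpow (C := 1) (α := 1) (by simp) (by norm_num)
    (Eventually.of_forall fun w => ?_) ?_
  · rw [norm_logGradient, Real.rpow_neg_one, one_mul]
  · have : Measurable logGradient := by
      unfold logGradient
      fun_prop
    exact this.aestronglyMeasurable

/-- The regularized kernel is dominated by a multiple of `1 / ‖x - y‖`, uniformly in `ε`, as long as
the midpoint of `x` and `y` stays away from the circle. -/
theorem norm_integral_regInv_smul_unitVec_le {R σ ε : ℝ} (hε : 0 < ε) {x y : Plane} (hxy : x ≠ y)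
    (hσ : (‖x‖ + ‖y‖) / 2 ≤ σ) (hσR : σ < R) :
    ‖∫ θ in (0 : ℝ)..(2 * Real.pi),
      (R * regInv ε (‖x - R • unitVec θ‖ ^ 2 - ‖y - R • unitVec θ‖ ^ 2)) • unitVec θ‖
    ≤ (σ * (2 * Real.pi / (R - σ)) + 2 * Real.pi) / 2 * ‖x - y‖⁻¹ := by
  have hr : 0 < ‖x - y‖ := norm_pos_iff.mpr (sub_ne_zero.mpr hxy)
  have hs := (abs_norm_sq_sub_div_le hxy).trans hσ
  have hA := abs_cosMoment_le (hs.trans_lt hσR) (by positivity : 0 < ε / (2 * ‖x - y‖))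
  have hσ0 : 0 ≤ σ := (abs_nonneg _).trans hs
  have hB := hA.trans (add_le_add_left (mul_le_mul hs (div_le_div_of_nonneg_left
    (by positivity) (by linarith : 0 < R - σ) (by linarith)) (div_nonneg (by positivity)
    (by linarith)) hσ0) (2 * Real.pi))
  rw [integral_regInv_smul_unitVec hε hxy, norm_smul, norm_div, Real.norm_eq_abs,
    Real.norm_of_nonneg (by positivity : 0 ≤ 2 * ‖x - y‖ ^ 2)]
  calc _ ≤ (σ * (2 * Real.pi / (R - σ)) + 2 * Real.pi) / (2 * ‖x - y‖ ^ 2) * ‖x - y‖ := by gcongr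
    _ = _ := by field_simp

theorem tendsto_integral_regInv_smul_unitVec {R : ℝ} {x y : Plane} (hxy : x ≠ y)
    (hR : (‖x‖ + ‖y‖) / 2 < R) :
    Tendsto (fun ε => ∫ θ in (0 : ℝ)..(2 * Real.pi),
      (R * regInv ε (‖x - R • unitVec θ‖ ^ 2 - ‖y - R • unitVec θ‖ ^ 2)) • unitVec θ)
      (𝓝[>] 0) (𝓝 (Real.pi • logGradient (y - x))) := by
  have hr : 0 < ‖x - y‖ := norm_pos_iff.mpr (sub_ne_zero.mpr hxy)
  have h0 : Tendsto (fun ε : ℝ => ε / (2 * ‖x - y‖)) (𝓝[>] 0) (𝓝[>] 0) := by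
    refine tendsto_nhdsWithin_iff.mpr ⟨?_, ?_⟩
    · have : ContinuousAt (fun ε : ℝ => ε / (2 * ‖x - y‖)) 0 := by fun_prop
      simpa using this.tendsto.mono_left (nhdsWithin_le_nhds (s := Ioi 0))
    · filter_upwards [self_mem_nhdsWithin] with ε hε
      exact div_pos (mem_Ioi.mp hε) (by positivity)
  have h1 := (((tendsto_cosMoment ((abs_norm_sq_sub_div_le hxy).trans_lt hR)).comp h0).div_const
    (2 * ‖x - y‖ ^ 2)).smul_const (x - y)
  have h2 : (-(2 * Real.pi) / (2 * ‖x - y‖ ^ 2)) • (x - y) = Real.pi • logGradient (y - x) := by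
    rw [logGradient, norm_sub_rev y x, ← neg_sub y x, smul_neg, ← neg_smul, smul_smul]
    congr 1
    rw [neg_sub]
    field_simp
  rw [h2] at h1
  refine h1.congr' ?_
  filter_upwards [self_mem_nhdsWithin] with ε hε
  exact (integral_regInv_smul_unitVec hε hxy).symm

/-! ### Circular means -/

/-- The integral of `f` over the circle of radius `t` about `z` with respect to the polar angle. It
is Lipschitz in `t`, and the circular integral is `t` times it. -/
def circleMean (f : Plane → ℝ) (z : Plane) (t : ℝ) : ℝ :=
  ∫ θ in (0 : ℝ)..(2 * Real.pi), f (z + t • unitVec θ)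

theorem circularIntegral_eq (f : Plane → ℝ) (z : Plane) (t : ℝ) :
    circularIntegral f z t = t * circleMean f z t := by
  simp [circularIntegral, circleLineIntegral, circleMean]

theorem lipschitzWith_circleMean {f : Plane → ℝ} {L : NNReal} (hf : LipschitzWith L f) (z : Plane) :
    LipschitzWith (L * (2 * Real.pi).toNNReal) (circleMean f z) := by
  have hfc := hf.continuous
  refine LipschitzWith.of_dist_le_mul fun a b => ?_
  rw [dist_eq_norm, circleMean, circleMean, ← intervalIntegral.integral_sub
    (Continuous.intervalIntegrable (by fun_prop) _ _)
    (Continuous.intervalIntegrable (by fun_prop) _ _)]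
  have h := intervalIntegral.norm_integral_le_of_norm_le_const (a := 0) (b := 2 * Real.pi)
    (C := L * dist a b)
    (f := fun θ => f (z + a • unitVec θ) - f (z + b • unitVec θ)) fun θ _ => ?_
  · refine h.trans (le_of_eq ?_)
    rw [sub_zero, abs_of_pos (by positivity), NNReal.coe_mul, Real.coe_toNNReal _ (by positivity)]
    ring
  · rw [← dist_eq_norm]
    refine (hf.dist_le_mul _ _).trans (le_of_eq ?_)
    rw [dist_add_left, dist_eq_norm, ← sub_smul, norm_smul, norm_unitVec, mul_one, dist_eq_norm]

theorem continuous_circleMean {f : Plane → ℝ} (hf : Continuous f) :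
    Continuous fun p : Plane × ℝ => circleMean f p.1 p.2 := by
  unfold circleMean
  exact intervalIntegral.continuous_parametric_intervalIntegral_of_continuous' (by fun_prop) _ _

theorem filterIntegrand_eq (f : Plane → ℝ) (z : Plane) (t : ℝ) :
    filterIntegrand (circularIntegral f) z t
      = fun s => s * circleMean f z s * (1 / (s ^ 2 - t ^ 2)) := by
  funext s
  rw [filterIntegrand, circularIntegral_eq]

theorem filteredData_eq {f : Plane → ℝ} {L : NNReal} (hf : LipschitzWith L f) {R t : ℝ} (z : Plane)
    (ht : 0 < t) (htR : t < 2 * R) :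
    filteredData R (circularIntegral f) z t = pvClosedForm (circleMean f z) (2 * R) t := by
  rw [filteredData, filterIntegrand_eq]
  exact principalValue_eq (lipschitzWith_circleMean hf z) ht htR

theorem norm_smul_unitVec {R : ℝ} (hR : 0 ≤ R) (θ : ℝ) : ‖R • unitVec θ‖ = R := by
  rw [norm_smul, norm_unitVec, mul_one, Real.norm_of_nonneg hR]

theorem norm_sub_pos_and_lt_two_mul {R : ℝ} {y z : Plane} (hy : ‖y‖ < R) (hz : ‖z‖ = R) :
    0 < ‖y - z‖ ∧ ‖y - z‖ < 2 * R := by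
  constructor
  · have := norm_sub_norm_le z y
    rw [norm_sub_rev] at this
    linarith
  · linarith [norm_sub_le y z]

/-! ### The backprojection as a potential -/

/-- The regularized filtered data at the boundary point `z`. -/
def regFilteredData (R ε : ℝ) (f : Plane → ℝ) (y z : Plane) : ℝ :=
  ∫ s in (0 : ℝ)..(2 * R), s * circleMean f z s * regInv ε (s ^ 2 - ‖y - z‖ ^ 2)

/-- Polar coordinates about `z`; the disk lies within distance `2R` of its boundary point `z`. -/
theorem regFilteredData_eq_integral {R ε : ℝ} (hR : 0 ≤ R) (hε : 0 < ε) {f : Plane → ℝ}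
    (hf : Continuous f) (hsupp : ∀ x, R < ‖x‖ → f x = 0) (y : Plane) {z : Plane} (hz : ‖z‖ = R) :
    regFilteredData R ε f y z = ∫ x, f x * regInv ε (‖x - z‖ ^ 2 - ‖y - z‖ ^ 2) := by
  have hk := continuous_regInv hε
  rw [← integral_add_left_eq_self _ z]
  simp only [add_sub_cancel_left]
  rw [integral_eq_polar (ρ := 2 * R)
    (Φ := fun p => p.1 * (f (z + p.1 • unitVec p.2) * regInv ε (p.1 ^ 2 - ‖y - z‖ ^ 2)))
    (by positivity)]
  · rw [regFilteredData]
    refine intervalIntegral.integral_congr fun s _ => ?_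
    simp only
    rw [intervalIntegral.integral_const_mul, intervalIntegral.integral_mul_const, circleMean]
    ring
  · fun_prop
  · intro r θ hr
    rw [norm_smul_unitVec hr.le]
  · intro r θ hr
    simp only
    rw [hsupp, zero_mul, mul_zero]
    have := norm_sub_norm_le (r • unitVec θ) (-z)
    rw [norm_smul_unitVec (by linarith), norm_neg, hz, sub_neg_eq_add, add_comm] at this
    linarith
  · intro r θ
    simp only [unitVec_periodic θ]

theorem continuous_regFilteredData {R ε : ℝ} (hε : 0 < ε) {f : Plane → ℝ} (hf : Continuous f)
    (y : Plane) : Continuous (regFilteredData R ε f y) := by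
  have hk := continuous_regInv hε
  have hm := continuous_circleMean hf
  have hm' : Continuous fun p : Plane × ℝ =>
      p.2 * circleMean f p.1 p.2 * regInv ε (p.2 ^ 2 - ‖y - p.1‖ ^ 2) :=
    (continuous_snd.mul hm).mul (hk.comp (by fun_prop))
  unfold regFilteredData
  exact intervalIntegral.continuous_parametric_intervalIntegral_of_continuous' hm' _ _

/-- The regularized backprojection as an area integral of `f` against the regularized kernel. -/
theorem integral_regFilteredData {R ε : ℝ} (hR : 0 ≤ R) (hε : 0 < ε) {f : Plane → ℝ}
    (hf : Continuous f) (hsupp : ∀ x, R < ‖x‖ → f x = 0) (y : Plane) :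
    ∫ θ in (0 : ℝ)..(2 * Real.pi), regFilteredData R ε f y (R • unitVec θ) • R • unitVec θ
      = ∫ x, f x • ∫ θ in (0 : ℝ)..(2 * Real.pi),
        (R * regInv ε (‖x - R • unitVec θ‖ ^ 2 - ‖y - R • unitVec θ‖ ^ 2)) • unitVec θ := by
  have hk := continuous_regInv hε
  set F : ℝ → Plane → Plane := fun θ x =>
    (f x * regInv ε (‖x - R • unitVec θ‖ ^ 2 - ‖y - R • unitVec θ‖ ^ 2)) • R • unitVec θ with hF
  have hFc : Continuous (Function.uncurry F) := by
    simp only [hF, Function.uncurry_def]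
    fun_prop
  have hint : Integrable (Function.uncurry F)
      ((volume.restrict (uIoc 0 (2 * Real.pi))).prod volume) := by
    have h1 : IntegrableOn (Function.uncurry F)
        (uIoc 0 (2 * Real.pi) ×ˢ Metric.closedBall (0 : Plane) R) (volume.prod volume) := by
      refine (hFc.continuousOn.integrableOn_compact
        ((isCompact_uIcc (a := (0 : ℝ)) (b := 2 * Real.pi)).prod
          (isCompact_closedBall (0 : Plane) R))).mono_set ?_
      exact prod_mono uIoc_subset_uIcc le_rfl
    have h2 : IntegrableOn (Function.uncurry F)
        (uIoc 0 (2 * Real.pi) ×ˢ (univ : Set Plane)) (volume.prod volume) := by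
      refine h1.of_forall_sdiff_eq_zero (measurableSet_uIoc.prod MeasurableSet.univ) ?_
      rintro ⟨θ, x⟩ ⟨⟨hθ, -⟩, hn⟩
      have hx : R < ‖x‖ := by
        by_contra hle
        exact hn ⟨hθ, mem_closedBall_zero_iff.mpr (not_lt.mp hle)⟩
      simp [hF, hsupp x hx]
    rwa [IntegrableOn, ← Measure.prod_restrict, Measure.restrict_univ] at h2
  calc _ = ∫ θ in (0 : ℝ)..(2 * Real.pi), ∫ x, F θ x := by
        refine intervalIntegral.integral_congr fun θ _ => ?_
        rw [regFilteredData_eq_integral hR hε hf hsupp y (norm_smul_unitVec hR θ),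
          ← integral_smul_const]
    _ = ∫ x, ∫ θ in (0 : ℝ)..(2 * Real.pi), F θ x := intervalIntegral_integral_swap hint
    _ = _ := by
        refine integral_congr_ae (Eventually.of_forall fun x => ?_)
        simp only
        rw [← intervalIntegral.integral_smul]
        refine intervalIntegral.integral_congr fun θ _ => ?_
        simp only [hF]
        module

/-- The regularized kernels converge dominatedly to `π (y - x) / ‖y - x‖²`. Since `‖y‖ < R`, the
midpoints of `y` and the points of the disk stay in a smaller concentric disk. -/
theorem tendsto_integral_kernel {R : ℝ} {f : Plane → ℝ}
    (hf : Continuous f) (hfc : HasCompactSupport f) (hsupp : ∀ x, R < ‖x‖ → f x = 0) {y : Plane}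
    (hy : ‖y‖ < R) :
    Tendsto (fun ε => ∫ x, f x • ∫ θ in (0 : ℝ)..(2 * Real.pi),
        (R * regInv ε (‖x - R • unitVec θ‖ ^ 2 - ‖y - R • unitVec θ‖ ^ 2)) • unitVec θ)
      (𝓝[>] 0) (𝓝 (∫ x, f x • Real.pi • logGradient (y - x))) := by
  set σ := (R + ‖y‖) / 2 with hσ
  set C := (σ * (2 * Real.pi / (R - σ)) + 2 * Real.pi) / 2 with hC
  have hσR : σ < R := by rw [hσ]; linarith
  have hne : ∀ᵐ x : Plane, x ≠ y := by simp [ae_iff]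
  refine tendsto_integral_filter_of_dominated_convergence
    (fun x => C * ‖f x • logGradient (y - x)‖) ?_ ?_ ?_ ?_
  · filter_upwards [self_mem_nhdsWithin] with ε hε
    have hk := continuous_regInv hε
    refine (hf.smul ?_).aestronglyMeasurable
    exact intervalIntegral.continuous_parametric_intervalIntegral_of_continuous' (by fun_prop) _ _
  · filter_upwards [self_mem_nhdsWithin] with ε hε
    filter_upwards [hne] with x hx
    rcases lt_or_ge R ‖x‖ with h | h
    · simp [hsupp x h]
    · rw [norm_smul, norm_smul, norm_logGradient, norm_sub_rev y x]
      have := norm_integral_regInv_smul_unitVec_le (R := R) hε hx (σ := σ) (by rw [hσ]; linarith) hσR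
      calc _ ≤ ‖f x‖ * (C * ‖x - y‖⁻¹) := by gcongr
        _ = _ := by ring
  · refine Integrable.const_mul (Integrable.norm ?_) C
    have h1 : Integrable fun w => f (y - w) • logGradient w := by
      refine locallyIntegrable_logGradient.integrable_smul_left_of_hasCompactSupport
        (by fun_prop) ?_
      exact hfc.comp_homeomorph (Homeomorph.subLeft y)
    have := h1.comp_sub_left y
    simpa using this
  · filter_upwards [hne] with x hx
    rcases lt_or_ge R ‖x‖ with h | h
    · simp [hsupp x h]
    · exact (tendsto_integral_regInv_smul_unitVec hx (by linarith)).const_smul _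

/-- The removal of the regularization commutes with the integral over the boundary circle. -/
theorem tendsto_integral_regFilteredData {R : ℝ} {f : Plane → ℝ} {L : NNReal}
    (hf : LipschitzWith L f) {y : Plane} (hy : ‖y‖ < R) :
    IntervalIntegrable (fun θ => pvClosedForm (circleMean f (R • unitVec θ)) (2 * R)
      ‖y - R • unitVec θ‖ • R • unitVec θ) volume 0 (2 * Real.pi) ∧
    Tendsto (fun ε => ∫ θ in (0 : ℝ)..(2 * Real.pi),
      regFilteredData R ε f y (R • unitVec θ) • R • unitVec θ) (𝓝[>] 0)
      (𝓝 (∫ θ in (0 : ℝ)..(2 * Real.pi), pvClosedForm (circleMean f (R • unitVec θ)) (2 * R)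
        ‖y - R • unitVec θ‖ • R • unitVec θ)) := by
  have hR : 0 < R := (norm_nonneg y).trans_lt hy
  have hm := continuous_circleMean hf.continuous
  have ht : ∀ θ, 0 < ‖y - R • unitVec θ‖ ∧ ‖y - R • unitVec θ‖ < 2 * R := fun θ =>
    norm_sub_pos_and_lt_two_mul hy (norm_smul_unitVec hR.le θ)
  set b : ℝ → ℝ := fun θ => ((L * (2 * Real.pi).toNNReal : NNReal) * (2 * R)
    + |circleMean f (R • unitVec θ) ‖y - R • unitVec θ‖|
      * (|Real.log ((2 * R) ^ 2 - ‖y - R • unitVec θ‖ ^ 2)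
        - Real.log (‖y - R • unitVec θ‖ ^ 2)| / 2)) * R with hb
  have hbc : Continuous b := by
    have h1 : Continuous fun θ => circleMean f (R • unitVec θ) ‖y - R • unitVec θ‖ :=
      hm.comp (f := fun θ => (R • unitVec θ, ‖y - R • unitVec θ‖)) (by fun_prop)
    have h2 : Continuous fun θ => Real.log ((2 * R) ^ 2 - ‖y - R • unitVec θ‖ ^ 2) :=
      Continuous.log (by fun_prop) fun θ => by nlinarith [ht θ]
    have h3 : Continuous fun θ => Real.log (‖y - R • unitVec θ‖ ^ 2) :=
      Continuous.log (by fun_prop) fun θ => pow_ne_zero 2 (ht θ).1.ne'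
    fun_prop
  have hlim : ∀ θ, Tendsto (fun ε => regFilteredData R ε f y (R • unitVec θ) • R • unitVec θ)
      (𝓝[>] 0) (𝓝 (pvClosedForm (circleMean f (R • unitVec θ)) (2 * R)
        ‖y - R • unitVec θ‖ • R • unitVec θ)) := fun θ =>
    (tendsto_integral_regInv (lipschitzWith_circleMean hf _) (ht θ).1 (ht θ).2).smul_const _
  have hbound : ∀ ε > 0, ∀ θ,
      ‖regFilteredData R ε f y (R • unitVec θ) • R • unitVec θ‖ ≤ b θ := by
    intro ε hε θ
    rw [norm_smul, norm_smul_unitVec hR.le]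
    exact mul_le_mul_of_nonneg_right
      (abs_integral_regInv_le (lipschitzWith_circleMean hf _) (ht θ).1 (ht θ).2 hε) hR.le
  have hmeas : ∀ ε > 0, Continuous fun θ =>
      regFilteredData R ε f y (R • unitVec θ) • R • unitVec θ := by
    intro ε hε
    have := continuous_regFilteredData (R := R) hε hf.continuous y
    fun_prop
  refine ⟨?_, ?_⟩
  · refine (hbc.intervalIntegrable 0 (2 * Real.pi)).mono_fun' ?_ ?_
    · have hu : Tendsto (fun n : ℕ => 1 / ((n : ℝ) + 1)) atTop (𝓝[>] 0) :=
        tendsto_nhdsWithin_iff.mpr ⟨tendsto_one_div_add_atTop_nhds_zero_nat,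
          Eventually.of_forall fun n => mem_Ioi.mpr (by positivity)⟩
      exact aestronglyMeasurable_of_tendsto_ae atTop
        (fun n : ℕ => (hmeas _ (by positivity : 0 < 1 / ((n : ℝ) + 1))).aestronglyMeasurable)
        (Eventually.of_forall fun θ => (hlim θ).comp hu)
    · refine Eventually.of_forall fun θ => ?_
      refine le_of_tendsto (hlim θ).norm ?_
      filter_upwards [self_mem_nhdsWithin] with ε hε
      exact hbound ε hε θ
  · refine intervalIntegral.tendsto_integral_filter_of_dominated_convergence b ?_ ?_
      (hbc.intervalIntegrable _ _) ?_
    · filter_upwards [self_mem_nhdsWithin] with ε hε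
      exact (hmeas ε hε).aestronglyMeasurable
    · filter_upwards [self_mem_nhdsWithin] with ε hε
      exact Eventually.of_forall fun θ _ => hbound ε hε θ
    · exact Eventually.of_forall fun θ _ => hlim θ

theorem backprojectionIntegrand_eq {R : ℝ} {f : Plane → ℝ} {L : NNReal} (hf : LipschitzWith L f)
    {y : Plane} (hy : ‖y‖ < R) (θ : ℝ) :
    backprojectionIntegrand R (circularIntegral f) y (0 + R • unitVec θ)
      = pvClosedForm (circleMean f (R • unitVec θ)) (2 * R) ‖y - R • unitVec θ‖ • unitVec θ := by
  have hR : 0 < R := (norm_nonneg y).trans_lt hy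
  have ht := norm_sub_pos_and_lt_two_mul hy (norm_smul_unitVec hR.le θ)
  rw [zero_add, backprojectionIntegrand, filteredData_eq hf _ ht.1 ht.2, outerNormal,
    inv_smul_smul₀ hR.ne']

theorem circleLineIntegrable_backprojectionIntegrand {R : ℝ} {f : Plane → ℝ} {L : NNReal}
    (hf : LipschitzWith L f) {y : Plane} (hy : ‖y‖ < R) :
    CircleLineIntegrable (backprojectionIntegrand R (circularIntegral f) y) 0 R := by
  have hR : 0 < R := (norm_nonneg y).trans_lt hy
  have h := (tendsto_integral_regFilteredData hf hy).1.smul R⁻¹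
  rw [CircleLineIntegrable]
  refine h.congr ?_
  intro θ _
  simp only [Pi.smul_apply]
  rw [backprojectionIntegrand_eq hf hy, smul_comm, inv_smul_smul₀ hR.ne']

/-- Inside the circle the backprojection is `π` times the gradient of the logarithmic potential
of `f`. -/
theorem backprojection_eq {R : ℝ} {f : Plane → ℝ} {L : NNReal} (hf : LipschitzWith L f)
    (hfc : HasCompactSupport f) (hsupp : ∀ x, R < ‖x‖ → f x = 0) {y : Plane} (hy : ‖y‖ < R) :
    backprojection R (circularIntegral f) y = Real.pi • ∫ x, f x • logGradient (y - x) := by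
  have hR : 0 < R := (norm_nonneg y).trans_lt hy
  have h1 := (tendsto_integral_regFilteredData hf hy).2
  have h2 := tendsto_integral_kernel hf.continuous hfc hsupp hy
  have h3 : backprojection R (circularIntegral f) y
      = ∫ θ in (0 : ℝ)..(2 * Real.pi), pvClosedForm (circleMean f (R • unitVec θ)) (2 * R)
        ‖y - R • unitVec θ‖ • R • unitVec θ := by
    rw [backprojection, circleLineIntegral]
    refine intervalIntegral.integral_congr fun θ _ => ?_
    rw [backprojectionIntegrand_eq hf hy, smul_comm]
  rw [h3, ← integral_smul]
  simp_rw [smul_comm Real.pi]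
  refine tendsto_nhds_unique h1 (h2.congr' ?_)
  filter_upwards [self_mem_nhdsWithin] with ε hε
  exact (integral_regFilteredData hR.le hε hf.continuous hsupp y).symm

/-! ### The divergence of the potential -/

theorem sum_apply_single_mul (D : Plane →L[ℝ] ℝ) (v : Plane) :
    ∑ i : Fin 2, D (EuclideanSpace.single i (1 : ℝ)) * v i = D v := by
  conv_rhs => rw [← (EuclideanSpace.basisFun (Fin 2) ℝ).sum_repr v]
  simp [mul_comm]

/-- In polar coordinates about `y` the weight `1 / r` of `logGradient` cancels the area density, and
the remaining radial derivative integrates to `f y` on every ray. -/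
theorem integral_fderiv_logGradient {R : ℝ} (hR : 0 ≤ R) {f : Plane → ℝ} (hf : ContDiff ℝ 1 f)
    (hsupp : ∀ x, R < ‖x‖ → f x = 0) {y : Plane} (hy : ‖y‖ < R) :
    ∫ w, fderiv ℝ f (y - w) (logGradient w) = 2 * Real.pi * f y := by
  have hdf : Continuous (fderiv ℝ f) := hf.continuous_fderiv one_ne_zero
  have hfar : ∀ r θ, 2 * R ≤ r → R < ‖y - r • unitVec θ‖ := by
    intro r θ hr
    have := norm_sub_norm_le (r • unitVec θ) y
    rw [norm_smul_unitVec (by linarith), norm_sub_rev] at this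
    linarith
  have hΦ : Continuous fun p : ℝ × ℝ => fderiv ℝ f (y - p.1 • unitVec p.2) (unitVec p.2) :=
    (hdf.comp (by fun_prop)).clm_apply (by fun_prop)
  rw [integral_eq_polar (ρ := 2 * R)
    (Φ := fun p => fderiv ℝ f (y - p.1 • unitVec p.2) (unitVec p.2)) (by positivity) hΦ]
  · rw [intervalIntegral_intervalIntegral_swap
      (F := fun r θ => fderiv ℝ f (y - r • unitVec θ) (unitVec θ))]
    · have hray : ∀ θ, ∫ r in (0 : ℝ)..(2 * R), fderiv ℝ f (y - r • unitVec θ) (unitVec θ)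
          = f y := by
        intro θ
        have hd : ∀ r ∈ uIcc 0 (2 * R), HasDerivAt (fun r : ℝ => -f (y - r • unitVec θ))
            (fderiv ℝ f (y - r • unitVec θ) (unitVec θ)) r := by
          intro r _
          have h1 : HasDerivAt (fun r : ℝ => y - r • unitVec θ) (-unitVec θ) r := by
            simpa using ((hasDerivAt_id r).smul_const (unitVec θ)).const_sub y
          have h2 := (((hf.differentiable one_ne_zero)
            (y - r • unitVec θ)).hasFDerivAt.comp_hasDerivAt r h1).neg
          exact h2.congr_deriv (by simp)
        rw [intervalIntegral.integral_eq_sub_of_hasDerivAt hd]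
        · rw [hsupp _ (hfar _ θ le_rfl)]
          simp
        · exact (hΦ.comp (f := fun r : ℝ => (r, θ)) (by fun_prop)).intervalIntegrable _ _
      rw [intervalIntegral.integral_congr fun θ _ => hray θ]
      simp
    · exact (hΦ.continuousOn.integrableOn_compact (isCompact_uIcc.prod isCompact_uIcc)).mono_set
        (prod_mono uIoc_subset_uIcc uIoc_subset_uIcc)
  · intro r θ hr
    simp only
    rw [logGradient, norm_smul_unitVec hr.le, smul_smul, map_smul, smul_eq_mul]
    field_simp
  · intro r θ hr
    simp only
    have hev : f =ᶠ[𝓝 (y - r • unitVec θ)] fun _ => 0 := by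
      filter_upwards [(isOpen_lt continuous_const continuous_norm).mem_nhds (hfar r θ hr.le)]
        with x hx using hsupp x hx
    rw [hev.fderiv_eq, fderiv_fun_const]
    rfl
  · intro r θ
    simp only [unitVec_periodic θ]

/-- The bilinear map `(v, c) ↦ c • v`, for which the potential is a convolution. -/
def smulFlip : Plane →L[ℝ] ℝ →L[ℝ] Plane := (ContinuousLinearMap.lsmul ℝ ℝ).flip

theorem smulFlip_apply (v : Plane) (c : ℝ) : smulFlip v c = c • v := rfl

open scoped Convolution in
theorem integral_smul_logGradient_eq_convolution (f : Plane → ℝ) (y : Plane) :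
    ∫ x, f x • logGradient (y - x) = (logGradient ⋆[smulFlip, volume] f) y := by
  rw [convolution_def, ← integral_sub_left_eq_self _ volume y]
  simp only [sub_sub_cancel, smulFlip_apply]

/-- The gradient of the logarithmic potential is differentiable, with the derivative falling
on `f`. -/
theorem hasFDerivAt_potential {f : Plane → ℝ} (hf : ContDiff ℝ 1 f) (hfc : HasCompactSupport f)
    (y : Plane) : ∃ D : Plane →L[ℝ] Plane,
      HasFDerivAt (fun y => ∫ x, f x • logGradient (y - x)) D y ∧
      ∑ i : Fin 2, D (EuclideanSpace.single i (1 : ℝ)) i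
        = ∫ w, fderiv ℝ f (y - w) (logGradient w) := by
  have hdf : Continuous (fderiv ℝ f) := hf.continuous_fderiv one_ne_zero
  have h := hfc.hasFDerivAt_convolution_right smulFlip locallyIntegrable_logGradient hf y
  refine ⟨_, h.congr_of_eventuallyEq (Eventually.of_forall fun y =>
    integral_smul_logGradient_eq_convolution f y), ?_⟩
  have hint : ∀ v : Plane, Integrable fun w => fderiv ℝ f (y - w) v • logGradient w := by
    intro v
    refine locallyIntegrable_logGradient.integrable_smul_left_of_hasCompactSupport
      ((hdf.comp (by fun_prop)).clm_apply continuous_const) ?_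
    have h1 := (hfc.fderiv ℝ).comp_homeomorph (Homeomorph.subLeft y)
    exact h1.comp_left (g := fun D : Plane →L[ℝ] ℝ => D v) rfl
  have hcoord : ∀ i : Fin 2, ∀ v : Plane,
      (∫ w, fderiv ℝ f (y - w) v • logGradient w) i
        = ∫ w, fderiv ℝ f (y - w) v * logGradient w i := by
    intro i v
    have := (EuclideanSpace.proj (𝕜 := ℝ) i).integral_comp_comm (hint v)
    simpa using this.symm
  simp_rw [convolution_precompR_apply smulFlip locallyIntegrable_logGradient (hfc.fderiv ℝ) hdf,
    convolution_def, smulFlip_apply, hcoord]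
  rw [← integral_finsetSum]
  · simp_rw [sum_apply_single_mul]
  · intro i _
    have := (EuclideanSpace.proj (𝕜 := ℝ) i).integrable_comp (hint (EuclideanSpace.single i 1))
    simpa using this

theorem mainTheorem1 (R : ℝ) (hR : 0 < R) (f : Plane → ℝ) (hf : ContDiff ℝ 1 f)
    (hsupp : tsupport f ⊆ Metric.closedBall (0 : Plane) R) :
    ∀ y ∈ Metric.ball (0 : Plane) R,
      (∀ z ∈ Metric.sphere (0 : Plane) R,
        HasPrincipalValue (filterIntegrand (circularIntegral f) z ‖y - z‖) 0 (2 * R) ‖y - z‖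
          (filteredData R (circularIntegral f) z ‖y - z‖)) ∧
      CircleLineIntegrable (backprojectionIntegrand R (circularIntegral f) y) 0 R ∧
      DifferentiableAt ℝ (backprojection R (circularIntegral f)) y ∧
      f y = 1 / (2 * Real.pi ^ 2) * planeDiv (backprojection R (circularIntegral f)) y := by
  have hfc : HasCompactSupport f :=
    (isCompact_closedBall (0 : Plane) R).of_isClosed_subset (isClosed_tsupport f) hsupp
  have hzero : ∀ x, R < ‖x‖ → f x = 0 := fun x hx =>
    image_eq_zero_of_notMem_tsupport fun h => hx.not_ge (mem_closedBall_zero_iff.mp (hsupp h))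
  obtain ⟨L, hL⟩ := ContDiff.lipschitzWith_of_hasCompactSupport hfc hf one_ne_zero
  intro y hy
  rw [mem_ball_zero_iff] at hy
  obtain ⟨D, hD, hdiv⟩ := hasFDerivAt_potential hf hfc y
  have hV : HasFDerivAt (backprojection R (circularIntegral f)) (Real.pi • D) y := by
    refine (hD.const_smul Real.pi).congr_of_eventuallyEq ?_
    filter_upwards [Metric.isOpen_ball.mem_nhds (mem_ball_zero_iff.mpr hy)] with x hx
    exact backprojection_eq hL hfc hzero (mem_ball_zero_iff.mp hx)
  refine ⟨fun z hz => ?_, circleLineIntegrable_backprojectionIntegrand hL hy,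
    hV.differentiableAt, ?_⟩
  · have ht := norm_sub_pos_and_lt_two_mul hy (mem_sphere_zero_iff_norm.mp hz)
    rw [filteredData_eq hL z ht.1 ht.2, filterIntegrand_eq]
    exact hasPrincipalValue_pvClosedForm (lipschitzWith_circleMean hL z) ht.1 ht.2
  · rw [planeDiv, hV.fderiv]
    simp only [_root_.smul_apply, PiLp.smul_apply, smul_eq_mul]
    rw [← Finset.mul_sum, hdiv, integral_fderiv_logGradient hR.le hf hzero hy]
    field_simp

end
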